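/- Let $\mathcal E$ be an exact category, that is, an additive category with a class of short exact sequences for which there is an embedding of $\mathcal E$ as a full, extension-closed subcategory of an abelian category such that the class consists of exactly the sequences of $\mathcal E$ that are short exact in the abelian category. Let $\mathcal C$ and $\mathcal Z$ be full subcategories of $\mathcal E$, and let $\mathcal C^{\perp}$ be the class of objects $X$ of $\mathcal E$ with $\operatorname{Ext}^1_{\mathcal E}(C,X)=0$ for all $C\in\mathcal C$. Assume: 1. $(\mathcal C,\mathcal C^{\perp})$ is a cotorsion pair, i.e. an object $X$ of $\mathcal E$ lies in $\mathcal C$ if and only if $\operatorname{Ext}^1_{\mathcal E}(X,Y)=0$ for all $Y\in\mathcal C^{\perp}$; it is complete, i.e. for every object $X$ of $\mathcal E$ there are short exact sequences $0\to X\to I\to P\to 0$ and $0\to I'\to P'\to X\to 0$ of $\mathcal E$ with $I,I'\in\mathcal C^{\perp}$ and $P,P'\in\mathcal C$; and it is hereditary, i.e. $\mathcal C$ is closed under kernels of admissible epimorphisms of $\mathcal E$. 2. $\mathcal C^{\perp}\subseteq\mathcal Z$. 3. For every short exact sequence $0\to X\to Y\to W\to 0$ of $\mathcal E$ with all three objects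 in $\mathcal C$: if $X,W\in\mathcal Z$ then $Y\in\mathcal Z$, and if $X,Y\in\mathcal Z$ then $W\in\mathcal Z$. (That is, $\mathcal Z\cap\mathcal C$ is closed under extensions and under cokernels of admissible monomorphisms in $\mathcal C$.) Call a morphism of $\mathcal C$ a $\mathcal C$-admissible monomorphism (epimorphism) if it is the first (second) map of a short exact sequence of $\mathcal E$ all of whose objects lie in $\mathcal C$. Then $\mathcal C$ admits a Waldhausen category structure in which the cofibrations are the $\mathcal C$-admissible monomorphisms, and the weak equivalences are the morphisms of $\mathcal C$ that factor as a $\mathcal C$-admissible monomorphism with cokernel in $\mathcal C\cap\mathcal Z$ followed by a $\mathcal C$-admissible epimorphism with kernel in $\mathcal C^{\perp}$. Explicitly: $\mathcal C$ has a zero object; the cofibrations and the weak equivalences each form a subcategory of $\mathcal C$ containing all isomorphisms; every map $0\to A$ is a cofibration; for every cofibration $A\to B$ and every map $A\to C$ in $\mathcal C$ the pushout $B+_AC$ exists in $\mathcal C$ and $C\to B+_AC$ is a cofibration; and (Gluing Lemma) for every commutative diagram in $\mathcal C$ $$\begin{array}{ccccc} C&\leftarrow& A&\to& B\\ \downarrow&&\downarrow&&\downarrow\\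 C'&\leftarrow& A'&\to& B'\end{array}$$ in which $A\to B$ and $A'\to B'$ are cofibrations and the vertical maps are weak equivalences, the induced map $B+_AC\to B'+_{A'}C'$ is a weak equivalence. -/

import Mathlib

universe v u v' u'

open CategoryTheory CategoryTheory.Limits

namespace ExactCotorsion

/-- An exact structure on an additive category `E`: a class of sequences `0 ⟶ A ⟶ B ⟶ C ⟶ 0` in `E`
for which there is an embedding of `E` as a full subcategory of an abelian category `𝒜`, closed under
extensions, such that the class consists of exactly those sequences which become short exact
in `𝒜`. -/
structure ExactStructure (E : Type u) [Category.{v} E] [Preadditive E]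
    [HasZeroObject E] [HasBinaryBiproducts E] where
  /-- the distinguished short exact sequences -/
  conflation : ObjectProperty (ShortComplex E)
  exists_embedding : ∃ (𝒜 : Type u') (_ : Category.{v'} 𝒜) (_ : Abelian 𝒜) (F : E ⥤ 𝒜)
    (_ : F.Full) (_ : F.Faithful) (_ : F.Additive),
    (∀ S : ShortComplex E, conflation S ↔ (S.map F).ShortExact) ∧
    (∀ T : ShortComplex 𝒜, T.ShortExact →
      F.essImage T.X₁ → F.essImage T.X₃ → F.essImage T.X₂)

section Conflations

/-! Notions that depend only on a class of short exact sequences. -/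

variable {D : Type u} [Category.{v} D] [HasZeroMorphisms D] (conf : ObjectProperty (ShortComplex D))

/-- Morphisms that are an admissible monomorphism with a cokernel in `W`. -/
def AdmissibleMonoWithCokernelIn (W : ObjectProperty D) : MorphismProperty D :=
  fun _ B i => ∃ (Q : D) (p : B ⟶ Q) (w : i ≫ p = 0), conf (ShortComplex.mk i p w) ∧ W Q

/-- Morphisms that are an admissible epimorphism with a kernel in `W`. -/
def AdmissibleEpiWithKernelIn (W : ObjectProperty D) : MorphismProperty D :=
  fun B _ p => ∃ (K : D) (i : K ⟶ B) (w : i ≫ p = 0), conf (ShortComplex.mk i p w) ∧ W K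

/-- The admissible monomorphisms: the first maps of the distinguished sequences. -/
def AdmissibleMono : MorphismProperty D := AdmissibleMonoWithCokernelIn conf ⊤

def ClosedUnderExtensions (W : ObjectProperty D) : Prop :=
  ∀ S : ShortComplex D, conf S → W S.X₁ → W S.X₃ → W S.X₂

def ClosedUnderCokernelsOfAdmissibleMonos (W : ObjectProperty D) : Prop :=
  ∀ S : ShortComplex D, conf S → W S.X₁ → W S.X₂ → W S.X₃

def ClosedUnderKernelsOfAdmissibleEpis (W : ObjectProperty D) : Prop :=
  ∀ S : ShortComplex D, conf S → W S.X₂ → W S.X₃ → W S.X₁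

end Conflations

/-- A Waldhausen category structure on a category `D`. -/
structure WaldhausenStructure (D : Type u) [Category.{v} D] where
  hasZeroObject : HasZeroObject D
  /-- the cofibrations -/
  cof : MorphismProperty D
  /-- the weak equivalences -/
  weq : MorphismProperty D
  /-- the cofibrations form a subcategory -/
  cof_multiplicative : cof.IsMultiplicative
  /-- the weak equivalences form a subcategory -/
  weq_multiplicative : weq.IsMultiplicative
  /-- isomorphisms are cofibrations -/
  cof_of_isIso : ∀ {A B : D} (f : A ⟶ B), IsIso f → cof f
  /-- the map from a zero object to any object is a cofibration -/
  cof_of_isZero : ∀ {O A : D} (f : O ⟶ A), IsZero O → cof f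
  /-- pushouts of cofibrations along arbitrary maps exist -/
  hasPushout_of_cof : ∀ {A B C : D} (j : A ⟶ C) (i : A ⟶ B), cof i → HasPushout j i
  /-- cofibrations are stable under cobase change -/
  cof_of_isPushout : ∀ {A B C P : D} {j : A ⟶ C} {i : A ⟶ B} {inl : C ⟶ P} {inr : B ⟶ P},
    IsPushout j i inl inr → cof i → cof inl
  /-- isomorphisms are weak equivalences -/
  weq_of_isIso : ∀ {A B : D} (f : A ⟶ B), IsIso f → weq f
  /-- the Gluing Lemma: `φ` is the map induced on pushouts by `γ`, `α`, `β` -/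
  gluing : ∀ {A B C P A' B' C' P' : D}
    {j : A ⟶ C} {i : A ⟶ B} {inl : C ⟶ P} {inr : B ⟶ P}
    {j' : A' ⟶ C'} {i' : A' ⟶ B'} {inl' : C' ⟶ P'} {inr' : B' ⟶ P'}
    (α : A ⟶ A') (β : B ⟶ B') (γ : C ⟶ C') (φ : P ⟶ P'),
    cof i → cof i' →
    IsPushout j i inl inr → IsPushout j' i' inl' inr' →
    j ≫ γ = α ≫ j' → i ≫ β = α ≫ i' →
    weq α → weq β → weq γ →
    inl ≫ φ = γ ≫ inl' → inr ≫ φ = β ≫ inr' →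
    weq φ

namespace ExactStructure

variable {E : Type u} [Category.{v} E] [Preadditive E] [HasZeroObject E] [HasBinaryBiproducts E]
  (X : ExactStructure.{v, u, v', u'} E)

/-- An extension of `A` by `B`: a distinguished sequence `0 ⟶ B ⟶ M ⟶ A ⟶ 0`. -/
structure Extension (A B : E) where
  M : E
  i : B ⟶ M
  p : M ⟶ A
  w : i ≫ p = 0
  conf : X.conflation (ShortComplex.mk i p w)

/-- Two extensions are equivalent if they are isomorphic by an isomorphism that is the identity
on `A` and on `B`. -/
def extensionSetoid (A B : E) : Setoid (X.Extension A B) where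
  r S T := ∃ e : S.M ≅ T.M, S.i ≫ e.hom = T.i ∧ e.hom ≫ T.p = S.p
  iseqv :=
    { refl := fun S => ⟨Iso.refl _, by simp, by simp⟩
      symm := by
        rintro S T ⟨e, h₁, h₂⟩
        exact ⟨e.symm, by simp [← h₁], by simp [← h₂]⟩
      trans := by
        rintro S T U ⟨e, h₁, h₂⟩ ⟨e', h₁', h₂'⟩
        exact ⟨e ≪≫ e', by simp [← h₁', ← h₁], by simp [h₂, h₂']⟩ }

/-- The (underlying set of the) group `Ext¹(A, B)`: equivalence classes of extensions
of `A` by `B`. -/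
def Ext1 (A B : E) : Type (max u v) := Quotient (X.extensionSetoid A B)

/-- `𝓛^⊥`: the objects `A` such that `Ext¹(P, A) = 0` for all `P` in `𝓛`. -/
def rightOrthogonal (𝓛 : ObjectProperty E) : ObjectProperty E :=
  fun A => ∀ P : E, 𝓛 P → Subsingleton (X.Ext1 P A)

/-- `^⊥𝓡`: the objects `A` such that `Ext¹(A, I) = 0` for all `I` in `𝓡`. -/
def leftOrthogonal (𝓡 : ObjectProperty E) : ObjectProperty E :=
  fun A => ∀ I : E, 𝓡 I → Subsingleton (X.Ext1 A I)

/-- `(𝓛, 𝓡)` is a cotorsion pair. -/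
structure IsCotorsionPair (𝓛 𝓡 : ObjectProperty E) : Prop where
  right_eq : X.rightOrthogonal 𝓛 = 𝓡
  left_eq : X.leftOrthogonal 𝓡 = 𝓛

/-- `(𝓛, 𝓡)` is a complete cotorsion pair. -/
structure IsCompleteCotorsionPair (𝓛 𝓡 : ObjectProperty E) : Prop
    extends X.IsCotorsionPair 𝓛 𝓡 where
  exists_right_resolution : ∀ A : E, ∃ (I P : E) (i : A ⟶ I) (p : I ⟶ P) (w : i ≫ p = 0),
    X.conflation (ShortComplex.mk i p w) ∧ 𝓡 I ∧ 𝓛 P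
  exists_left_resolution : ∀ A : E, ∃ (I P : E) (i : I ⟶ P) (p : P ⟶ A) (w : i ≫ p = 0),
    X.conflation (ShortComplex.mk i p w) ∧ 𝓡 I ∧ 𝓛 P

/-- `(𝓛, 𝓡)` is a complete hereditary cotorsion pair. -/
structure IsCompleteHereditaryCotorsionPair (𝓛 𝓡 : ObjectProperty E) : Prop
    extends X.IsCompleteCotorsionPair 𝓛 𝓡 where
  hereditary : ClosedUnderKernelsOfAdmissibleEpis X.conflation 𝓛

/-- The distinguished sequences of the full subcategory `𝒞`: the sequences of objects of `𝒞`
that are distinguished in `E`. -/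
def conflationOn (𝒞 : ObjectProperty E) : ObjectProperty (ShortComplex 𝒞.FullSubcategory) :=
  fun S => X.conflation (S.map 𝒞.ι)

/-- The morphisms of `𝒞` that factor as a `𝒞`-admissible monomorphism with cokernel in `𝒞 ∩ 𝒵`
followed by a `𝒞`-admissible epimorphism with kernel in `𝒞^⊥`. -/
def cotorsionWeq (𝒞 𝒵 : ObjectProperty E) : MorphismProperty 𝒞.FullSubcategory :=
  fun A B f => ∃ (M : 𝒞.FullSubcategory) (i : A ⟶ M) (p : M ⟶ B), i ≫ p = f ∧
    AdmissibleMonoWithCokernelIn (X.conflationOn 𝒞) (𝒵.inverseImage 𝒞.ι) i ∧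
    AdmissibleEpiWithKernelIn (X.conflationOn 𝒞) ((X.rightOrthogonal 𝒞).inverseImage 𝒞.ι) p

end ExactStructure

end ExactCotorsion

/-!
The exact category `𝒞` is extension-closed in `E`, hence in the ambient abelian category, and the
objects of `ω = 𝒞 ∩ 𝒞^⊥` are injective relative to its short exact sequences. So an admissible
epimorphism onto `B` with kernel `I` in `𝒞^⊥` is, up to isomorphism, the projection `I ⊞ B ⟶ B`, and
a weak equivalence is a map `f : A ⟶ B` for which some `(a, f) : A ⟶ I ⊞ B`, with `I` in `ω`, is a
monomorphism with cokernel in `𝒵`. Such a cokernel is a cone of `f`. By the closure properties of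
`𝒵`, membership of the cone in `𝒵` does not depend on the choice of `a`, as soon as `(a, f)` is an
admissible monomorphism (`ConeContext.monoWithCokernelIn_lift_of_lift`).

Every object of `𝒞` embeds into an object of `ω` with cokernel in `𝒞`, by completeness, so cones can
be chosen for the three components of a morphism of short exact sequences in such a way that they
form a short exact sequence as well (`ConeContext.exists_shortExact_cone`, by the snake lemma). For
the gluing lemma this is applied to the sequences `0 ⟶ A ⟶ C ⊞ B ⟶ P ⟶ 0` attached to the pushouts:
the cone of `P ⟶ P'` is the cokernel of an admissible monomorphism between objects of `𝒵`.
Composites are handled similarly, and the statements on cofibrations hold because `𝒞` is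
extension-closed. `EmbeddedContext` transports all this from the abelian category to `𝒞`.
-/

namespace ExactCotorsion

/-! ### Cokernels and short exact sequences in abelian categories -/

section Abelian

open scoped ZeroObject

variable {𝒜 : Type u'} [Category.{v'} 𝒜] [Abelian 𝒜]

lemma shortExact_inl_snd (A B : 𝒜) :
    (ShortComplex.mk (biprod.inl : A ⟶ A ⊞ B) (biprod.snd : A ⊞ B ⟶ B) (by simp)).ShortExact :=
  (ShortComplex.Splitting.ofHasBinaryBiproduct A B).shortExact

lemma shortExact_cokernel {A B : 𝒜} (f : A ⟶ B) [Mono f] :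
    (ShortComplex.mk f (cokernel.π f) (by simp)).ShortExact where
  exact := ShortComplex.exact_cokernel f

lemma shortExact_biprod_map {S T : ShortComplex 𝒜} (hS : S.ShortExact) (hT : T.ShortExact) :
    (ShortComplex.mk (biprod.map S.f T.f) (biprod.map S.g T.g) (by
      ext <;> simp)).ShortExact := by
  have := hS.mono_f
  have := hT.mono_f
  have := hS.epi_g
  have := hT.epi_g
  refine ShortComplex.ShortExact.mk' ?_ (inferInstanceAs (Mono (biprod.map S.f T.f)))
    (inferInstanceAs (Epi (biprod.map S.g T.g)))
  refine ShortComplex.exact_of_f_is_kernel _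
    (KernelFork.IsLimit.ofι' _ _ fun {A} k hk => ⟨biprod.lift
      (hS.exact.lift (k ≫ biprod.fst) ?_) (hT.exact.lift (k ≫ biprod.snd) ?_), ?_⟩)
  · simpa using hk =≫ biprod.fst
  · simpa using hk =≫ biprod.snd
  · ext <;> simp

/-- The sequence of cokernels of a morphism of short exact sequences whose outer components are
monomorphisms is short exact, by the snake lemma. -/
lemma exists_shortExact_cokernel {S S' : ShortComplex 𝒜} (φ : S ⟶ S') (hS : S.ShortExact)
    (hS' : S'.ShortExact) [Mono φ.τ₁] [Mono φ.τ₃] :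
    Mono φ.τ₂ ∧ ∃ T : ShortComplex 𝒜, T.ShortExact ∧ Nonempty (T.X₁ ≅ cokernel φ.τ₁) ∧
      Nonempty (T.X₂ ≅ cokernel φ.τ₂) ∧ Nonempty (T.X₃ ≅ cokernel φ.τ₃) := by
  have := hS.mono_f
  have := hS'.mono_f
  let D : ShortComplex.SnakeInput 𝒜 :=
    { L₀ := kernel φ
      L₁ := S
      L₂ := S'
      L₃ := cokernel φ
      v₀₁ := kernel.ι φ
      v₁₂ := φ
      v₂₃ := cokernel.π φ
      w₀₂ := kernel.condition φ
      w₁₃ := cokernel.condition φ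
      h₀ := kernelIsKernel φ
      h₃ := cokernelIsCokernel φ
      L₁_exact := hS.exact
      epi_L₁_g := hS.epi_g
      L₂_exact := hS'.exact
      mono_L₂_f := hS'.mono_f }
  have h₀ : IsZero D.L₀.X₃ :=
    IsZero.of_iso (isZero_zero _) ((D.h₀τ₃.conePointUniqueUpToIso
      (kernelIsKernel φ.τ₃)).trans (kernel.ofMono φ.τ₃))
  have : Epi D.L₂.g := hS'.epi_g
  refine ⟨ShortComplex.mono_τ₂_of_exact_of_mono φ hS.exact, D.L₃,
    ShortComplex.ShortExact.mk' D.L₃_exact ?_ D.epi_L₃_g,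
    ⟨D.h₃τ₁.coconePointUniqueUpToIso (colimit.isColimit _)⟩,
    ⟨D.h₃τ₂.coconePointUniqueUpToIso (colimit.isColimit _)⟩,
    ⟨D.h₃τ₃.coconePointUniqueUpToIso (colimit.isColimit _)⟩⟩
  exact (D.L₂'.exact_iff_mono (h₀.eq_of_src _ _)).1 D.L₂'_exact

/-- For monomorphisms `t` and `s`, the cokernel of `t ≫ s` is an extension of the cokernel of `s`
by the cokernel of `t`. -/
lemma exists_shortExact_cokernel_comp {A : 𝒜} {S : ShortComplex 𝒜} (hS : S.ShortExact)
    (t : A ⟶ S.X₁) [Mono t] :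
    ∃ T : ShortComplex 𝒜, T.ShortExact ∧ Nonempty (T.X₁ ≅ cokernel t) ∧
      Nonempty (T.X₂ ≅ cokernel (t ≫ S.f)) ∧ Nonempty (T.X₃ ≅ S.X₃) := by
  let R : ShortComplex 𝒜 := ShortComplex.mk (𝟙 A) (0 : A ⟶ 0) (by simp)
  have hR : R.ShortExact :=
    ShortComplex.ShortExact.mk' ((R.exact_iff_epi rfl).2 (inferInstanceAs (Epi (𝟙 A))))
      (inferInstanceAs (Mono (𝟙 A))) ⟨fun _ _ _ => (isZero_zero 𝒜).eq_of_src _ _⟩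
  let φ : R ⟶ S := { τ₁ := t, τ₂ := t ≫ S.f, τ₃ := 0 }
  have : Mono φ.τ₁ := ‹Mono t›
  have : Mono φ.τ₃ := ⟨fun _ _ _ => (isZero_zero 𝒜).eq_of_tgt _ _⟩
  obtain ⟨-, T, hT, e₁, e₂, ⟨e₃⟩⟩ := exists_shortExact_cokernel φ hR hS
  exact ⟨T, hT, e₁, e₂, ⟨e₃ ≪≫ cokernelZeroIsoTarget⟩⟩

/-- If `t` followed by an epimorphism `g` with kernel `K` is a monomorphism, then the cokernel of
`t` is an extension of the cokernel of `t ≫ g` by `K`. -/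
lemma exists_shortExact_cokernel_comp_epi {A : 𝒜} {S : ShortComplex 𝒜} (hS : S.ShortExact)
    (t : A ⟶ S.X₂) [Mono (t ≫ S.g)] :
    ∃ T : ShortComplex 𝒜, T.ShortExact ∧ Nonempty (T.X₁ ≅ S.X₁) ∧
      Nonempty (T.X₂ ≅ cokernel t) ∧ Nonempty (T.X₃ ≅ cokernel (t ≫ S.g)) := by
  let R : ShortComplex 𝒜 := ShortComplex.mk (0 : 0 ⟶ A) (𝟙 A) (by simp)
  have hR : R.ShortExact :=
    ShortComplex.ShortExact.mk' ((R.exact_iff_mono rfl).2 (inferInstanceAs (Mono (𝟙 A))))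
      ⟨fun _ _ _ => (isZero_zero 𝒜).eq_of_tgt _ _⟩ (inferInstanceAs (Epi (𝟙 A)))
  let φ : R ⟶ S := { τ₁ := 0, τ₂ := t, τ₃ := t ≫ S.g }
  have : Mono φ.τ₁ := ⟨fun _ _ _ => (isZero_zero 𝒜).eq_of_tgt _ _⟩
  have : Mono φ.τ₃ := ‹_›
  obtain ⟨-, T, hT, ⟨e₁⟩, e₂, e₃⟩ := exists_shortExact_cokernel φ hR hS
  exact ⟨T, hT, ⟨e₁ ≪≫ cokernelZeroIsoTarget⟩, e₂, e₃⟩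

/-- The cobase change of a short exact sequence along a map out of its left-hand term. -/
lemma exists_shortExact_of_isPushout {A B C N Q : 𝒜} {j : A ⟶ C} {i : A ⟶ B} {inl : C ⟶ N}
    {inr : B ⟶ N} (h : IsPushout j i inl inr) {q : B ⟶ Q} {w : i ≫ q = 0}
    (hS : (ShortComplex.mk i q w).ShortExact) :
    ∃ (r : N ⟶ Q) (w' : inl ≫ r = 0), inr ≫ r = q ∧ (ShortComplex.mk inl r w').ShortExact := by
  have hi : Mono i := hS.mono_f
  have hq : Epi q := hS.epi_g
  have hr := h.inr_desc (0 : C ⟶ Q) q (by simp [w])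
  have hl := h.inl_desc (0 : C ⟶ Q) q (by simp [w])
  refine ⟨h.desc 0 q (by simp [w]), hl, hr,
    ShortComplex.ShortExact.mk' ?_
      (MorphismProperty.of_isPushout (P := .monomorphisms 𝒜) h hi)
      (epi_of_epi_fac hr)⟩
  refine ShortComplex.exact_of_g_is_cokernel _
    (CokernelCofork.IsColimit.ofπ _ _ (fun {Y} k hk => hS.exact.desc (inr ≫ k) ?_) ?_ ?_)
  · simp [← h.w_assoc, hk]
  · intro Y k hk
    apply h.hom_ext
    · simp [reassoc_of% hl, hk]
    · rw [reassoc_of% hr]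
      exact hS.exact.g_desc _ _
  · intro Y k hk b hb
    rw [← cancel_epi q]
    refine Eq.trans ?_ (hS.exact.g_desc _ _).symm
    rw [← hb, reassoc_of% hr]

lemma shortExact_of_isPushout {A B C N : 𝒜} {j : A ⟶ C} {i : A ⟶ B} {inl : C ⟶ N}
    {inr : B ⟶ N} (h : IsPushout j i inl inr) [Mono i] :
    (ShortComplex.mk (biprod.lift j (-i)) (biprod.desc inl inr) (by simp [h.w])).ShortExact :=
  ShortComplex.ShortExact.mk' h.exact_shortComplex
    (mono_of_mono_fac (show biprod.lift j (-i) ≫ (-biprod.snd) = i by simp)) h.epi_shortComplex_g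

end Abelian

/-! ### Morphisms with a trivial cone -/

section ConeEquivalences

open scoped ZeroObject

variable {𝒜 : Type u'} [Category.{v'} 𝒜] [Abelian 𝒜]

/-- The monomorphisms of an abelian category with a cokernel in `Q`. -/
def monoWithCokernelIn (Q : ObjectProperty 𝒜) : MorphismProperty 𝒜 :=
  fun _ _ f => Mono f ∧ Q (cokernel f)

/-- The morphisms `f : A ⟶ B` with a cone in `Z`: a cone of `f` is the cokernel of a monomorphism
`(a, f) : A ⟶ I ⊞ B` with `I` in `ω`. -/
def weqWithConeIn (ω Z : ObjectProperty 𝒜) : MorphismProperty 𝒜 :=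
  fun A _ f => ∃ (I : 𝒜) (a : A ⟶ I), ω I ∧ monoWithCokernelIn Z (biprod.lift a f)

/-- The data needed to form cones in an extension-closed class `P` of objects of an abelian
category: a class `ω` of objects into which all objects of `P` embed, with a cokernel in `P`, and a
class `Z ⊆ P` of objects regarded as trivial. -/
structure ConeContext (P ω Z : ObjectProperty 𝒜) : Prop where
  iso_P : P.IsClosedUnderIsomorphisms
  iso_Z : Z.IsClosedUnderIsomorphisms
  ext_P : ClosedUnderExtensions ShortComplex.ShortExact P
  ext_Z : ClosedUnderExtensions ShortComplex.ShortExact Z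
  Z_le_P : Z ≤ P
  ω_le_Z : ω ≤ Z
  ω_of_isZero : ∀ A : 𝒜, IsZero A → ω A
  ω_biprod : ∀ A B : 𝒜, ω A → ω B → ω (A ⊞ B)
  cok_Z : ∀ S : ShortComplex 𝒜, S.ShortExact → Z S.X₁ → Z S.X₂ → P S.X₃ → Z S.X₃
  exists_mono : ∀ A : 𝒜, P A → ∃ (I : 𝒜) (a : A ⟶ I), ω I ∧ monoWithCokernelIn P a

lemma monoWithCokernelIn_of_shortExact {Q : ObjectProperty 𝒜} [Q.IsClosedUnderIsomorphisms]
    {S : ShortComplex 𝒜} (hS : S.ShortExact) (h : Q S.X₃) : monoWithCokernelIn Q S.f := by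
  have := hS.mono_f
  exact ⟨this, Q.prop_of_iso
    (hS.gIsCokernel.coconePointUniqueUpToIso (colimit.isColimit (parallelPair S.f 0))) h⟩

lemma monoWithCokernelIn.comp {Q : ObjectProperty 𝒜} [Q.IsClosedUnderIsomorphisms]
    (hQ : ClosedUnderExtensions ShortComplex.ShortExact Q) {A B C : 𝒜} {t : A ⟶ B} {s : B ⟶ C}
    (ht : monoWithCokernelIn Q t) (hs : monoWithCokernelIn Q s) :
    monoWithCokernelIn Q (t ≫ s) := by
  have := ht.1
  have := hs.1
  obtain ⟨T, hT, ⟨e₁⟩, ⟨e₂⟩, ⟨e₃⟩⟩ := exists_shortExact_cokernel_comp (shortExact_cokernel s) t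
  exact ⟨inferInstance,
    Q.prop_of_iso e₂ (hQ T hT (Q.prop_of_iso e₁.symm ht.2) (Q.prop_of_iso e₃.symm hs.2))⟩

namespace ConeContext

variable {P ω Z : ObjectProperty 𝒜} (h : ConeContext P ω Z)
include h

lemma monoWithCokernelIn_of_isIso {A B : 𝒜} (f : A ⟶ B) [IsIso f] : monoWithCokernelIn Z f :=
  ⟨inferInstance, h.ω_le_Z _ (h.ω_of_isZero _ ((isZero_zero 𝒜).of_iso (cokernel.ofEpi f)))⟩

/-- Whether a cone of `f` is in `Z` does not depend on the map `a : A ⟶ I` used to form it: the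
cones formed with `a` and with `b` both are quotients of the one formed with `(a, b)`, by `J` and by
`I` respectively. -/
lemma monoWithCokernelIn_lift_of_lift {A B I J : 𝒜} {f : A ⟶ B} {a : A ⟶ I} {b : A ⟶ J}
    (hI : ω I) (hJ : ω J) (ha : monoWithCokernelIn Z (biprod.lift a f))
    (hb : monoWithCokernelIn P (biprod.lift b f)) : monoWithCokernelIn Z (biprod.lift b f) := by
  have := h.iso_P
  have := h.iso_Z
  let t : A ⟶ I ⊞ (J ⊞ B) := biprod.lift a (biprod.lift b f)
  let R : ShortComplex 𝒜 := ShortComplex.mk (biprod.inl ≫ biprod.inr : J ⟶ I ⊞ (J ⊞ B))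
    (biprod.map (𝟙 I) biprod.snd) (by simp)
  have hR : R.ShortExact :=
    ShortComplex.Splitting.shortExact
      { r := biprod.snd ≫ biprod.fst
        s := biprod.map (𝟙 I) biprod.inr
        f_r := by simp [R]
        s_g := by simp [R]; ext <;> simp
        id := by ext <;> simp [R] }
  have e₁ : t ≫ R.g = biprod.lift a f := by ext <;> simp [t, R]
  have e₂ : t ≫ biprod.snd = biprod.lift b f := by ext <;> simp [t]
  have : Mono (t ≫ R.g) := by rw [e₁]; exact ha.1
  have : Mono (t ≫ (biprod.snd : I ⊞ (J ⊞ B) ⟶ _)) := by rw [e₂]; exact hb.1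
  obtain ⟨T, hT, ⟨u₁⟩, ⟨u₂⟩, ⟨u₃⟩⟩ := exists_shortExact_cokernel_comp_epi hR t
  obtain ⟨T', hT', ⟨v₁⟩, ⟨v₂⟩, ⟨v₃⟩⟩ :=
    exists_shortExact_cokernel_comp_epi (shortExact_inl_snd I (J ⊞ B)) t
  have ht : Z (cokernel t) := by
    refine Z.prop_of_iso u₂ (h.ext_Z T hT (Z.prop_of_iso u₁.symm (h.ω_le_Z _ hJ))
      (Z.prop_of_iso u₃.symm ?_))
    rw [e₁]; exact ha.2
  have v₃' : T'.X₃ ≅ cokernel (biprod.lift b f) := v₃ ≪≫ cokernelIsoOfEq e₂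
  exact ⟨hb.1, Z.prop_of_iso v₃' (h.cok_Z T' hT' (Z.prop_of_iso v₁.symm (h.ω_le_Z _ hI))
    (Z.prop_of_iso v₂.symm ht) (P.prop_of_iso v₃'.symm hb.2))⟩

lemma weqWithConeIn_iff {A B I : 𝒜} {f : A ⟶ B} {a : A ⟶ I} (hI : ω I)
    (ha : monoWithCokernelIn P (biprod.lift a f)) :
    weqWithConeIn ω Z f ↔ Z (cokernel (biprod.lift a f)) :=
  ⟨fun ⟨_, _, hJ, hb⟩ => (h.monoWithCokernelIn_lift_of_lift hJ hI hb ha).2,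
    fun hZ => ⟨I, a, hI, ha.1, hZ⟩⟩

lemma monoWithCokernelIn_lift {A B I : 𝒜} (f : A ⟶ B) {a : A ⟶ I}
    (ha : monoWithCokernelIn P a) (hB : P B) : monoWithCokernelIn P (biprod.lift a f) := by
  have := h.iso_P
  have := ha.1
  have e : biprod.lift a f ≫ biprod.fst = a := by simp
  have : Mono (biprod.lift a f ≫ biprod.fst) := by rwa [e]
  let R : ShortComplex 𝒜 := ShortComplex.mk (biprod.inr : B ⟶ I ⊞ B) biprod.fst (by simp)
  have hR : R.ShortExact :=
    ShortComplex.Splitting.shortExact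
      { r := biprod.snd
        s := biprod.inl
        f_r := by simp [R]
        s_g := by simp [R]
        id := by ext <;> simp [R] }
  obtain ⟨T, hT, ⟨u₁⟩, ⟨u₂⟩, ⟨u₃⟩⟩ := exists_shortExact_cokernel_comp_epi hR (biprod.lift a f)
  refine ⟨mono_of_mono _ biprod.fst, P.prop_of_iso u₂ (h.ext_P T hT (P.prop_of_iso u₁.symm hB)
    (P.prop_of_iso u₃.symm ?_))⟩
  change P (cokernel (biprod.lift a f ≫ biprod.fst))
  rw [e]
  exact ha.2

/-- A morphism of short exact sequences in `P` has a short exact sequence of cones. -/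
lemma exists_shortExact_cone {S S' : ShortComplex 𝒜} (φ : S ⟶ S') (hS : S.ShortExact)
    (hS' : S'.ShortExact) (h₂ : P S.X₂) (h₃ : P S.X₃) (h₁' : P S'.X₁) (h₃' : P S'.X₃) :
    ∃ T : ShortComplex 𝒜, T.ShortExact ∧ P T.X₃ ∧ (weqWithConeIn ω Z φ.τ₁ ↔ Z T.X₁) ∧
      (weqWithConeIn ω Z φ.τ₂ ↔ Z T.X₂) ∧ (weqWithConeIn ω Z φ.τ₃ ↔ Z T.X₃) := by
  have := h.iso_P
  have := h.iso_Z
  obtain ⟨J, b, hJ, hb⟩ := h.exists_mono _ h₂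
  obtain ⟨L, l, hL, hl⟩ := h.exists_mono _ h₃
  -- an embedding of `S` into the split sequence `J ⟶ J ⊞ L ⟶ L`, next to `φ`
  let S'' : ShortComplex 𝒜 := ShortComplex.mk
    (biprod.map (biprod.inl : J ⟶ J ⊞ L) S'.f) (biprod.map (biprod.snd : J ⊞ L ⟶ L) S'.g)
    (by ext <;> simp)
  have hS'' : S''.ShortExact := shortExact_biprod_map (shortExact_inl_snd J L) hS'
  let ψ : S ⟶ S'' :=
    { τ₁ := biprod.lift (S.f ≫ b) φ.τ₁
      τ₂ := biprod.lift (biprod.lift b (S.g ≫ l)) φ.τ₂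
      τ₃ := biprod.lift l φ.τ₃
      comm₁₂ := by
        dsimp [S'']
        ext
        · simp
        · simp
        · simp [φ.comm₁₂]
      comm₂₃ := by
        dsimp [S'']
        ext
        · simp
        · simp [φ.comm₂₃] }
  have m₁ : monoWithCokernelIn P (biprod.lift (S.f ≫ b) φ.τ₁) :=
    h.monoWithCokernelIn_lift _ ((monoWithCokernelIn_of_shortExact hS h₃).comp h.ext_P hb) h₁'
  have m₃ : monoWithCokernelIn P (biprod.lift l φ.τ₃) := h.monoWithCokernelIn_lift _ hl h₃'
  have : Mono ψ.τ₁ := m₁.1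
  have : Mono ψ.τ₃ := m₃.1
  obtain ⟨hm, T, hT, ⟨e₁⟩, ⟨e₂⟩, ⟨e₃⟩⟩ := exists_shortExact_cokernel ψ hS hS''
  have q₁ : P T.X₁ := P.prop_of_iso e₁.symm m₁.2
  have q₃ : P T.X₃ := P.prop_of_iso e₃.symm m₃.2
  have m₂ : monoWithCokernelIn P (biprod.lift (biprod.lift b (S.g ≫ l)) φ.τ₂) :=
    ⟨hm, P.prop_of_iso e₂ (h.ext_P T hT q₁ q₃)⟩
  refine ⟨T, hT, q₃, ?_, ?_, ?_⟩
  · exact (h.weqWithConeIn_iff hJ m₁).trans (Z.prop_iff_of_iso e₁).symm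
  · exact (h.weqWithConeIn_iff (h.ω_biprod _ _ hJ hL) m₂).trans (Z.prop_iff_of_iso e₂).symm
  · exact (h.weqWithConeIn_iff hL m₃).trans (Z.prop_iff_of_iso e₃).symm

lemma weqWithConeIn_biprod_map {A B A' B' : 𝒜} {f : A ⟶ A'} {g : B ⟶ B'} (hA : P A) (hB : P B)
    (hA' : P A') (hB' : P B') (hf : weqWithConeIn ω Z f) (hg : weqWithConeIn ω Z g) :
    weqWithConeIn ω Z (biprod.map f g) := by
  let φ : ShortComplex.mk (biprod.inl : A ⟶ A ⊞ B) biprod.snd (by simp) ⟶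
      ShortComplex.mk (biprod.inl : A' ⟶ A' ⊞ B') biprod.snd (by simp) :=
    { τ₁ := f, τ₂ := biprod.map f g, τ₃ := g }
  obtain ⟨T, hT, -, i₁, i₂, i₃⟩ := h.exists_shortExact_cone φ (shortExact_inl_snd A B)
    (shortExact_inl_snd A' B') (h.ext_P _ (shortExact_inl_snd A B) hA hB) hB hA' hB'
  exact i₂.2 (h.ext_Z T hT (i₁.1 hf) (i₃.1 hg))

/-- The gluing lemma, by comparing the short exact sequences `0 ⟶ A ⟶ C ⊞ B ⟶ N ⟶ 0` and
`0 ⟶ A' ⟶ C' ⊞ B' ⟶ N' ⟶ 0` of the two pushouts: the cone of `φ` is the cokernel of a map between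
objects of `Z`. -/
lemma weqWithConeIn_of_isPushout {A B C N A' B' C' N' : 𝒜}
    {j : A ⟶ C} {i : A ⟶ B} {inl : C ⟶ N} {inr : B ⟶ N}
    {j' : A' ⟶ C'} {i' : A' ⟶ B'} {inl' : C' ⟶ N'} {inr' : B' ⟶ N'}
    {α : A ⟶ A'} {β : B ⟶ B'} {γ : C ⟶ C'} {φ : N ⟶ N'} [Mono i] [Mono i']
    (sq : IsPushout j i inl inr) (sq' : IsPushout j' i' inl' inr')
    (hj : j ≫ γ = α ≫ j') (hi : i ≫ β = α ≫ i')
    (hα : weqWithConeIn ω Z α) (hβ : weqWithConeIn ω Z β) (hγ : weqWithConeIn ω Z γ)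
    (hl : inl ≫ φ = γ ≫ inl') (hr : inr ≫ φ = β ≫ inr')
    (hB : P B) (hC : P C) (hN : P N) (hA' : P A') (hB' : P B') (hC' : P C') (hN' : P N') :
    weqWithConeIn ω Z φ := by
  have hCB : P (C ⊞ B) := h.ext_P _ (shortExact_inl_snd C B) hC hB
  have hS := shortExact_of_isPushout sq
  have hS' := shortExact_of_isPushout sq'
  let ψ : ShortComplex.mk (biprod.lift j (-i)) (biprod.desc inl inr) (by simp [sq.w]) ⟶
      ShortComplex.mk (biprod.lift j' (-i')) (biprod.desc inl' inr') (by simp [sq'.w]) :=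
    { τ₁ := α
      τ₂ := biprod.map γ β
      τ₃ := φ
      comm₁₂ := by dsimp; ext <;> simp [hj, hi]
      comm₂₃ := by dsimp; ext <;> simp [hl, hr] }
  obtain ⟨T, hT, q, i₁, i₂, i₃⟩ := h.exists_shortExact_cone ψ hS hS' hCB hN hA' hN'
  exact i₃.2 (h.cok_Z T hT (i₁.1 hα)
    (i₂.1 (h.weqWithConeIn_biprod_map hC hB hC' hB' hγ hβ)) q)

lemma weqWithConeIn_of_isIso {A B : 𝒜} (f : A ⟶ B) [IsIso f] : weqWithConeIn ω Z f := by
  have e : (biprod.inl : (0 : 𝒜) ⟶ 0 ⊞ B) = 0 := (isZero_zero 𝒜).eq_of_src _ _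
  have : IsIso (biprod.lift (0 : A ⟶ 0) f) :=
    ⟨biprod.snd ≫ inv f, by simp, biprod.hom_ext' _ _ (by simp [e]) (biprod.hom_ext _ _
      ((isZero_zero 𝒜).eq_of_tgt _ _) (by simp))⟩
  exact ⟨0, 0, h.ω_of_isZero _ (isZero_zero 𝒜), h.monoWithCokernelIn_of_isIso _⟩

/-- The cone formed with `(a, f ≫ b)` is an extension of the cone of `g` by that of `f`. -/
lemma weqWithConeIn_comp {A B C : 𝒜} {f : A ⟶ B} {g : B ⟶ C} (hf : weqWithConeIn ω Z f)
    (hg : weqWithConeIn ω Z g) : weqWithConeIn ω Z (f ≫ g) := by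
  have := h.iso_Z
  obtain ⟨I, a, hI, ha⟩ := hf
  obtain ⟨J, b, hJ, hb⟩ := hg
  have := hb.1
  have hI₀ : (ShortComplex.mk (𝟙 I) (0 : I ⟶ 0) (by simp)).ShortExact :=
    ShortComplex.Splitting.shortExact
      { r := 𝟙 I
        s := 0
        f_r := by simp
        s_g := (isZero_zero 𝒜).eq_of_src _ _
        id := by simp }
  have hs : monoWithCokernelIn Z (biprod.map (𝟙 I) (biprod.lift b g)) :=
    monoWithCokernelIn_of_shortExact (shortExact_biprod_map hI₀
      (shortExact_cokernel (biprod.lift b g)))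
      (h.ext_Z _ (shortExact_inl_snd 0 _) (h.ω_le_Z _ (h.ω_of_isZero _ (isZero_zero 𝒜))) hb.2)
  have := ha.comp h.ext_Z (hs.comp h.ext_Z
    (h.monoWithCokernelIn_of_isIso (biprod.associator I J C).inv))
  refine ⟨I ⊞ J, biprod.lift a (f ≫ b), h.ω_biprod _ _ hI hJ, ?_⟩
  convert this using 1
  ext <;> simp

end ConeContext

end ConeEquivalences

/-! ### Waldhausen structures on embedded exact categories -/

section Embedded

open scoped ZeroObject

variable {𝒜 : Type u'} [Category.{v'} 𝒜] [Abelian 𝒜]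
  {D : Type u} [Category.{v} D] [Preadditive D]

/-- Short exact sequences of objects isomorphic to images under `G` lift to `D`. -/
lemma exists_lift_of_shortExact {conf : ObjectProperty (ShortComplex D)} {G : D ⥤ 𝒜} [G.Additive]
    [G.Full] [G.Faithful] (hG : ∀ S : ShortComplex D, conf S ↔ (S.map G).ShortExact)
    {T : ShortComplex 𝒜} (hT : T.ShortExact) {A B C : D} (e₁ : G.obj A ≅ T.X₁)
    (e₂ : G.obj B ≅ T.X₂) (e₃ : G.obj C ≅ T.X₃) :
    ∃ w, conf (ShortComplex.mk (G.preimage (e₁.hom ≫ T.f ≫ e₂.inv))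
      (G.preimage (e₂.hom ≫ T.g ≫ e₃.inv)) w) := by
  refine ⟨G.map_injective (by simp), (hG _).2 (ShortComplex.shortExact_of_iso ?_ hT)⟩
  exact ShortComplex.isoMk e₁.symm e₂.symm e₃.symm
    ((congrArg (e₁.inv ≫ ·) (G.map_preimage _)).trans (e₁.inv_hom_id_assoc _))
    ((congrArg (e₂.inv ≫ ·) (G.map_preimage _)).trans (e₂.inv_hom_id_assoc _))

/-- An exact category `D`, embedded by `G` as an extension-closed full subcategory of an abelian
category, together with a class `R` of objects, injective relative to `conf`, into which all objects
embed, and a class `Z ⊇ R` of objects regarded as trivial. -/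
structure EmbeddedContext (conf : ObjectProperty (ShortComplex D)) (G : D ⥤ 𝒜) [G.Additive]
    (R Z : ObjectProperty D) : Prop where
  conf_iff : ∀ S : ShortComplex D, conf S ↔ (S.map G).ShortExact
  ext_map : ClosedUnderExtensions ShortComplex.ShortExact ((⊤ : ObjectProperty D).map G)
  ext : ClosedUnderExtensions conf Z
  cok : ClosedUnderCokernelsOfAdmissibleMonos conf Z
  le : R ≤ Z
  of_isZero : ∀ A : D, IsZero A → R A
  biprod : ∀ A B : D, R A → R B → R.map G (G.obj A ⊞ G.obj B)
  exists_mono : ∀ A : D, ∃ (I : D) (a : A ⟶ I), R I ∧ AdmissibleMono conf a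
  exists_retraction : ∀ S : ShortComplex D, conf S → R S.X₁ → ∃ r : S.X₂ ⟶ S.X₁, S.f ≫ r = 𝟙 _

namespace EmbeddedContext

variable {conf : ObjectProperty (ShortComplex D)} {G : D ⥤ 𝒜} [G.Additive] [G.Full] [G.Faithful]
  {R Z : ObjectProperty D} (h : EmbeddedContext conf G R Z)
include h

lemma admissibleMonoWithCokernelIn_iff (W : ObjectProperty D) {A B : D} (i : A ⟶ B) :
    AdmissibleMonoWithCokernelIn conf W i ↔ monoWithCokernelIn (W.map G) (G.map i) := by
  constructor
  · rintro ⟨Q, p, w, hc, hQ⟩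
    exact monoWithCokernelIn_of_shortExact ((h.conf_iff _).1 hc) (W.prop_map_obj G hQ)
  · rintro ⟨_, hc⟩
    obtain ⟨Q, hQ, ⟨e⟩⟩ := (W.prop_map_iff G _).1 hc
    obtain ⟨w, hw⟩ := exists_lift_of_shortExact h.conf_iff (shortExact_cokernel (G.map i))
      (Iso.refl _) (Iso.refl _) e
    simp only [Iso.refl_hom, Iso.refl_inv, Category.id_comp, Category.comp_id,
      G.preimage_map] at w hw
    exact ⟨Q, _, w, hw, hQ⟩

lemma coneContext [HasZeroObject D] :
    ConeContext ((⊤ : ObjectProperty D).map G) (R.map G) (Z.map G) where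
  iso_P := inferInstance
  iso_Z := inferInstance
  ext_P := h.ext_map
  ext_Z := by
    intro T hT h₁ h₃
    obtain ⟨B, -, ⟨e₂⟩⟩ := h.ext_map T hT (ObjectProperty.map_monotone le_top _ _ h₁)
      (ObjectProperty.map_monotone le_top _ _ h₃)
    obtain ⟨A, hA, ⟨e₁⟩⟩ := h₁
    obtain ⟨C, hC, ⟨e₃⟩⟩ := h₃
    obtain ⟨w, hw⟩ := exists_lift_of_shortExact h.conf_iff hT e₁ e₂ e₃
    exact ⟨B, h.ext _ hw hA hC, ⟨e₂⟩⟩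
  Z_le_P := ObjectProperty.map_monotone le_top _
  ω_le_Z := ObjectProperty.map_monotone h.le _
  ω_of_isZero A hA :=
    ⟨0, h.of_isZero _ (isZero_zero D), ⟨(G.map_isZero (isZero_zero D)).iso hA⟩⟩
  ω_biprod := by
    rintro A B ⟨A', hA, ⟨a⟩⟩ ⟨B', hB, ⟨b⟩⟩
    exact (R.map G).prop_of_iso (biprod.mapIso a b) (h.biprod A' B' hA hB)
  cok_Z := by
    rintro T hT ⟨A, hA, ⟨e₁⟩⟩ ⟨B, hB, ⟨e₂⟩⟩ ⟨C, -, ⟨e₃⟩⟩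
    obtain ⟨w, hw⟩ := exists_lift_of_shortExact h.conf_iff hT e₁ e₂ e₃
    exact ⟨C, h.cok _ hw hA hB, ⟨e₃⟩⟩
  exists_mono := by
    rintro A ⟨A', -, ⟨e⟩⟩
    obtain ⟨I, a, hI, ha⟩ := h.exists_mono A'
    obtain ⟨Q, p, w, hc, hQ⟩ := ha
    have hS := (h.conf_iff _).1 hc
    have hS' : (ShortComplex.mk (e.inv ≫ G.map a) (G.map p)
        (by simp [← G.map_comp, w])).ShortExact :=
      ShortComplex.shortExact_of_iso
        (ShortComplex.isoMk (S₁ := (ShortComplex.mk a p w).map G) e (Iso.refl _) (Iso.refl _)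
          ((e.hom_inv_id_assoc _).trans (Category.comp_id _).symm)
          ((Category.id_comp _).trans (Category.comp_id _).symm)) hS
    exact ⟨_, _, R.prop_map_obj G hI, monoWithCokernelIn_of_shortExact hS'
      (ObjectProperty.prop_map_obj ⊤ G hQ)⟩

/-- As `R` consists of relative injectives, an admissible epimorphism `M ⟶ B` with kernel `K` in
`R` is a projection `K ⊞ B ⟶ B`; so a factorization through it is a monomorphism into `K ⊞ B`. -/
lemma exists_factorization_iff [HasZeroObject D] {A B : D} (f : A ⟶ B) :
    (∃ (M : D) (i : A ⟶ M) (p : M ⟶ B), i ≫ p = f ∧ AdmissibleMonoWithCokernelIn conf Z i ∧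
      AdmissibleEpiWithKernelIn conf R p) ↔
    weqWithConeIn (R.map G) (Z.map G) (G.map f) := by
  have hc := h.coneContext
  constructor
  · rintro ⟨M, i, p, rfl, hi, K, k, w, hk, hK⟩
    obtain ⟨r, hr⟩ := h.exists_retraction _ hk hK
    have hS := (h.conf_iff _).1 hk
    have := hS.epi_g
    let s : ((ShortComplex.mk k p w).map G).Splitting :=
      ShortComplex.Splitting.ofExactOfRetraction _ hS.exact (G.map r)
        ((G.map_comp _ _).symm.trans ((congrArg G.map hr).trans (G.map_id _))) hS.epi_g
    have hs : IsIso (biprod.lift (G.map r) (G.map p)) :=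
      inferInstanceAs (IsIso s.isoBinaryBiproduct.hom)
    refine ⟨G.obj K, G.map (i ≫ r), R.prop_map_obj G hK, ?_⟩
    have hi' := ((h.admissibleMonoWithCokernelIn_iff Z i).1 hi).comp hc.ext_Z
      (hc.monoWithCokernelIn_of_isIso (biprod.lift (G.map r) (G.map p)))
    convert hi' using 1
    ext <;> simp
  · rintro ⟨I, a, ⟨K, hK, ⟨e⟩⟩, ha⟩
    have hS := shortExact_inl_snd I (G.obj B)
    obtain ⟨M, -, ⟨e'⟩⟩ := h.ext_map _ hS ⟨K, trivial, ⟨e⟩⟩ ⟨B, trivial, ⟨Iso.refl _⟩⟩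
    obtain ⟨w, hw⟩ := exists_lift_of_shortExact h.conf_iff hS e e' (Iso.refl _)
    refine ⟨M, G.preimage (biprod.lift a (G.map f) ≫ e'.inv), _, G.map_injective ?_, ?_,
      K, _, w, hw, hK⟩
    · simp
    · rw [h.admissibleMonoWithCokernelIn_iff, G.map_preimage]
      exact ha.comp hc.ext_Z (hc.monoWithCokernelIn_of_isIso e'.inv)

/-- Pushouts of admissible monomorphisms exist in `D`, and `G` maps them to pushouts. -/
lemma exists_isPushout {A B C : D} (j : A ⟶ C) {i : A ⟶ B} (hi : AdmissibleMono conf i) :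
    ∃ (N : D) (inl : C ⟶ N) (inr : B ⟶ N), IsPushout j i inl inr ∧
      IsPushout (G.map j) (G.map i) (G.map inl) (G.map inr) ∧ AdmissibleMono conf inl := by
  obtain ⟨Q, q, w, hq, -⟩ := hi
  have sq := IsPushout.of_hasPushout (G.map j) (G.map i)
  obtain ⟨r, w', -, hr⟩ := exists_shortExact_of_isPushout sq ((h.conf_iff _).1 hq)
  obtain ⟨N, -, ⟨e⟩⟩ := h.ext_map _ hr ⟨C, trivial, ⟨Iso.refl _⟩⟩ ⟨Q, trivial, ⟨Iso.refl _⟩⟩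
  obtain ⟨w'', hw⟩ := exists_lift_of_shortExact h.conf_iff hr (Iso.refl _) e (Iso.refl _)
  have sq' : IsPushout (G.map j) (G.map i)
      (G.map (G.preimage ((Iso.refl (G.obj C)).hom ≫ pushout.inl (G.map j) (G.map i) ≫ e.inv)))
      (G.map (G.preimage (pushout.inr (G.map j) (G.map i) ≫ e.inv))) :=
    sq.of_iso (Iso.refl _) (Iso.refl _) (Iso.refl _) e.symm (by simp) (by simp) (by simp) (by simp)
  exact ⟨N, _, _, sq'.of_map_of_faithful G, sq', Q, _, w'', hw, trivial⟩

lemma isPushout_map {A B C N : D} {j : A ⟶ C} {i : A ⟶ B} {inl : C ⟶ N} {inr : B ⟶ N}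
    (sq : IsPushout j i inl inr) (hi : AdmissibleMono conf i) :
    IsPushout (G.map j) (G.map i) (G.map inl) (G.map inr) := by
  obtain ⟨N', inl', inr', sq', hsq, -⟩ := h.exists_isPushout j hi
  refine hsq.of_iso (Iso.refl _) (Iso.refl _) (Iso.refl _) (G.mapIso (sq'.isoIsPushout _ _ sq))
    (by simp) (by simp) ?_ ?_
  · simp [← G.map_comp]
  · simp [← G.map_comp]

/-- The Waldhausen structure, with the weak equivalences described by cones in the abelian
category. -/
theorem exists_waldhausenStructure [HasZeroObject D] :
    ∃ W : WaldhausenStructure D, W.cof = AdmissibleMono conf ∧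
      W.weq = (weqWithConeIn (R.map G) (Z.map G)).inverseImage G := by
  have hc := h.coneContext
  have hP (A : D) : (⊤ : ObjectProperty D).map G (G.obj A) :=
    ObjectProperty.prop_map_obj ⊤ G trivial
  have cof_iff {A B : D} (f : A ⟶ B) : AdmissibleMono conf f ↔
      monoWithCokernelIn ((⊤ : ObjectProperty D).map G) (G.map f) :=
    h.admissibleMonoWithCokernelIn_iff ⊤ f
  have cof_iso {A B : D} (f : A ⟶ B) [IsIso f] : AdmissibleMono conf f := (cof_iff f).2
    ⟨inferInstance, hc.Z_le_P _ (hc.monoWithCokernelIn_of_isIso (G.map f)).2⟩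
  have cof_comp {A B C : D} (f : A ⟶ B) (g : B ⟶ C) (hf : AdmissibleMono conf f)
      (hg : AdmissibleMono conf g) : AdmissibleMono conf (f ≫ g) := by
    rw [cof_iff, G.map_comp]
    exact ((cof_iff f).1 hf).comp hc.ext_P ((cof_iff g).1 hg)
  refine ⟨
    { hasZeroObject := inferInstance
      cof := AdmissibleMono conf
      weq := (weqWithConeIn (R.map G) (Z.map G)).inverseImage G
      cof_multiplicative := { id_mem := fun _ => cof_iso _, comp_mem := cof_comp }
      weq_multiplicative :=
        { id_mem := fun A => hc.weqWithConeIn_of_isIso (G.map (𝟙 A))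
          comp_mem := fun f g hf hg => by
            change weqWithConeIn _ _ (G.map (f ≫ g))
            rw [G.map_comp]
            exact hc.weqWithConeIn_comp hf hg }
      cof_of_isIso := fun f _ => cof_iso f
      cof_of_isZero := fun {O A} f hO => ?_
      hasPushout_of_cof := fun j i hi => ?_
      cof_of_isPushout := fun {A B C N j i inl inr} sq hi => ?_
      weq_of_isIso := fun f _ => hc.weqWithConeIn_of_isIso (G.map f)
      gluing := ?_ }, rfl, rfl⟩
  · have : Mono f := ⟨fun _ _ _ => hO.eq_of_tgt _ _⟩
    refine ⟨A, 𝟙 A, hO.eq_of_src _ _, (h.conf_iff _).2 (ShortComplex.ShortExact.mk' ?_ ?_ ?_),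
      trivial⟩
    · exact (ShortComplex.exact_iff_mono _ ((G.map_isZero hO).eq_of_src _ _)).2
        (inferInstanceAs (Mono (G.map (𝟙 A))))
    · exact ⟨fun _ _ _ => (G.map_isZero hO).eq_of_tgt _ _⟩
    · exact inferInstanceAs (Epi (G.map (𝟙 A)))
  · obtain ⟨_, _, _, sq, -⟩ := h.exists_isPushout j hi
    exact sq.hasPushout
  · obtain ⟨_, inl', inr', sq', -, hl⟩ := h.exists_isPushout j hi
    have := cof_comp _ _ hl (cof_iso (sq'.isoIsPushout _ _ sq).hom)
    simpa using this
  · intro A B C N A' B' C' N' j i inl inr j' i' inl' inr' α β γ φ hi hi' sq sq' hj hi'' hα hβ hγ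
      hl hr
    have := ((cof_iff i).1 hi).1
    have := ((cof_iff i').1 hi').1
    exact hc.weqWithConeIn_of_isPushout (h.isPushout_map sq hi) (h.isPushout_map sq' hi')
      (by simp only [← G.map_comp, hj]) (by simp only [← G.map_comp, hi'']) hα hβ hγ
      (by simp only [← G.map_comp, hl]) (by simp only [← G.map_comp, hr])
      (hP _) (hP _) (hP _) (hP _) (hP _) (hP _) (hP _)

end EmbeddedContext

end Embedded

/-! ### Vanishing of Ext¹ and cotorsion pairs -/

section Orthogonality

open scoped ZeroObject

variable {𝒜 : Type u'} [Category.{v'} 𝒜] [Abelian 𝒜]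

/-- The vanishing of `Ext¹(A, I)` in an abelian category, in the form: for every short exact
sequence `0 ⟶ B ⟶ M ⟶ A ⟶ 0`, every map `B ⟶ I` extends to `M`. -/
def ExtVanishes (A I : 𝒜) : Prop :=
  ∀ ⦃B M : 𝒜⦄ (i : B ⟶ M) (p : M ⟶ A) (w : i ≫ p = 0), (ShortComplex.mk i p w).ShortExact →
    ∀ f : B ⟶ I, ∃ g : M ⟶ I, i ≫ g = f

lemma ExtVanishes.of_isZero_left {A I : 𝒜} (hA : IsZero A) : ExtVanishes A I := by
  intro B M i p w hS f
  have : IsIso i := hS.isIso_f_iff.2 hA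
  exact ⟨inv i ≫ f, by simp⟩

lemma ExtVanishes.of_isZero_right {A I : 𝒜} (hI : IsZero I) : ExtVanishes A I :=
  fun _ _ _ _ _ _ _ => ⟨0, hI.eq_of_tgt _ _⟩

lemma ExtVanishes.of_iso {A I J : 𝒜} (e : I ≅ J) (h : ExtVanishes A I) : ExtVanishes A J := by
  intro B M i p w hS f
  obtain ⟨g, hg⟩ := h i p w hS (f ≫ e.inv)
  exact ⟨g ≫ e.hom, by simp [reassoc_of% hg]⟩

lemma ExtVanishes.biprod {A I J : 𝒜} (hI : ExtVanishes A I) (hJ : ExtVanishes A J) :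
    ExtVanishes A (I ⊞ J) := by
  intro B M i p w hS f
  obtain ⟨g, hg⟩ := hI i p w hS (f ≫ biprod.fst)
  obtain ⟨g', hg'⟩ := hJ i p w hS (f ≫ biprod.snd)
  exact ⟨biprod.lift g g', by ext <;> simp [hg, hg']⟩

/-- Given a short exact sequence `0 ⟶ B ⟶ M ⟶ S.X₂ ⟶ 0`, let `M'` be the preimage of `S.X₁` in `M`.
A map out of `B` extends to `M'`, as `M' / B` is `S.X₁`, and then to `M`, as `M / M'` is `S.X₃`. -/
lemma ExtVanishes.of_shortExact {S : ShortComplex 𝒜} (hS : S.ShortExact) {I : 𝒜}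
    (h₁ : ExtVanishes S.X₁ I) (h₃ : ExtVanishes S.X₃ I) : ExtVanishes S.X₂ I := by
  intro B M i p w hM f
  have := hS.mono_f
  have := hS.epi_g
  have hp : Epi p := hM.epi_g
  have hi : Mono i := hM.mono_f
  have sq := IsPullback.of_hasPullback p S.f
  have e : sq.lift i 0 (by simp [w]) ≫ pullback.fst p S.f = i := sq.lift_fst _ _ _
  have hB : (ShortComplex.mk (sq.lift i 0 (by simp [w])) (pullback.snd p S.f)
      (sq.lift_snd _ _ _)).ShortExact := by
    have : Mono (sq.lift i 0 (by simp [w])) := mono_of_mono_fac e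
    refine ShortComplex.ShortExact.mk' ?_ this
      (inferInstanceAs (Epi (pullback.snd p S.f)))
    refine ShortComplex.exact_of_f_is_kernel _ (KernelFork.IsLimit.ofι' _ _ fun {Y} k hk =>
      ⟨hM.exact.lift (k ≫ pullback.fst p S.f) ?_, ?_⟩)
    · simp [sq.w, reassoc_of% hk]
    · apply sq.hom_ext
      · rw [Category.assoc, e]
        exact hM.exact.lift_f _ _
      · simp [hk]
  have hM' : (ShortComplex.mk (pullback.fst p S.f) (p ≫ S.g)
      (by rw [sq.w_assoc, S.zero, comp_zero])).ShortExact := by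
    refine ShortComplex.ShortExact.mk' ?_ (inferInstanceAs (Mono (pullback.fst p S.f)))
      (inferInstanceAs (Epi (p ≫ S.g)))
    refine ShortComplex.exact_of_f_is_kernel _ (KernelFork.IsLimit.ofι' _ _ fun {Y} k hk =>
      ⟨sq.lift k (hS.exact.lift (k ≫ p) (by simpa using hk)) (by simp), sq.lift_fst _ _ _⟩)
  obtain ⟨f', hf'⟩ := h₁ _ _ _ hB f
  obtain ⟨g, hg⟩ := h₃ _ _ _ hM' f'
  exact ⟨g, by rw [← e, Category.assoc, hg, hf']⟩

variable {E : Type u} [Category.{v} E] [Preadditive E] [HasZeroObject E] [HasBinaryBiproducts E]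

/-- The trivial extension of `A` by `B`. -/
noncomputable def ExactStructure.splitExtension (X : ExactStructure.{v, u, v', u'} E) {F : E ⥤ 𝒜}
    [F.Additive] (hF : ∀ S : ShortComplex E, X.conflation S ↔ (S.map F).ShortExact) (A B : E) :
    X.Extension A B where
  M := B ⊞ A
  i := biprod.inl
  p := biprod.snd
  w := by simp
  conf := (hF _).2 ((ShortComplex.Splitting.ofHasBinaryBiproduct B A).map F).shortExact

/-- Extensions in an extension-closed subcategory are those of the ambient abelian category, so that
`Ext¹` vanishes in one if and only if it vanishes in the other. -/
lemma ExactStructure.subsingleton_ext1_iff (X : ExactStructure.{v, u, v', u'} E) {F : E ⥤ 𝒜}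
    [F.Additive] [F.Full] [F.Faithful]
    (hF : ∀ S : ShortComplex E, X.conflation S ↔ (S.map F).ShortExact)
    (hext : ∀ T : ShortComplex 𝒜, T.ShortExact →
      F.essImage T.X₁ → F.essImage T.X₃ → F.essImage T.X₂) (A I : E) :
    Subsingleton (X.Ext1 A I) ↔ ExtVanishes (F.obj A) (F.obj I) := by
  constructor
  · intro hs B M i p w hS f
    -- push the sequence out along `f` and lift the result to an extension in `E`, which splits
    have sq := IsPushout.of_hasPushout f i
    obtain ⟨r, w', -, hr⟩ := exists_shortExact_of_isPushout sq hS
    obtain ⟨N, ⟨e⟩⟩ := hext _ hr (F.obj_mem_essImage I) (F.obj_mem_essImage A)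
    obtain ⟨w'', hc⟩ := exists_lift_of_shortExact hF hr (Iso.refl _) e (Iso.refl _)
    let T : X.Extension A I := ⟨N, _, _, w'', hc⟩
    obtain ⟨u, hu⟩ : ∃ u : N ⟶ I ⊞ A, T.i ≫ u = biprod.inl := by
      obtain ⟨u, hu, -⟩ := Quotient.exact (hs.elim (Quotient.mk (X.extensionSetoid A I) T)
        (Quotient.mk _ (X.splitExtension hF A I)))
      exact ⟨u.hom, hu⟩
    have hT : F.map T.i = pushout.inl f i ≫ e.inv := by simp [T]
    have hu' : pushout.inl f i ≫ e.inv ≫ F.map (u ≫ biprod.fst) = 𝟙 (F.obj I) := by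
      rw [← Category.assoc, ← hT, ← F.map_comp, reassoc_of% hu, biprod.inl_fst, F.map_id]
    exact ⟨pushout.inr f i ≫ e.inv ≫ F.map (u ≫ biprod.fst), by
      rw [← pushout.condition_assoc, hu', Category.comp_id]⟩
  · intro hv
    -- every extension has a retraction onto `I`, hence is equivalent to the trivial one
    have key (T : X.Extension A I) :
        (X.extensionSetoid A I).r T (X.splitExtension hF A I) := by
      have hT := (hF _).1 T.conf
      obtain ⟨g, hg⟩ := hv _ _ _ hT (𝟙 _)
      have hg' : T.i ≫ F.preimage g = 𝟙 I := F.map_injective (by simpa using hg)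
      let φ : ShortComplex.mk T.i T.p T.w ⟶
          ShortComplex.mk (biprod.inl : I ⟶ I ⊞ A) biprod.snd (by simp) :=
        { τ₁ := 𝟙 I
          τ₂ := biprod.lift (F.preimage g) T.p
          τ₃ := 𝟙 A
          comm₁₂ := by dsimp; ext <;> simp [hg', T.w]
          comm₂₃ := by simp }
      have : IsIso (F.map φ.τ₂) := ShortComplex.isIso₂_of_shortExact_of_isIso₁₃'
        (F.mapShortComplex.map φ) hT ((hF _).1 (X.splitExtension hF A I).conf)
        (inferInstanceAs (IsIso (F.map (𝟙 I)))) (inferInstanceAs (IsIso (F.map (𝟙 A))))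
      have hφ : IsIso φ.τ₂ := isIso_of_reflects_iso φ.τ₂ F
      exact ⟨@asIso _ _ _ _ φ.τ₂ hφ, φ.comm₁₂.symm.trans (Category.id_comp _),
        φ.comm₂₃.trans (Category.comp_id _)⟩
    refine ⟨fun a b => ?_⟩
    induction a using Quotient.ind with | _ S =>
    induction b using Quotient.ind with | _ T =>
    exact Quotient.sound ((X.extensionSetoid A I).trans (key S)
      ((X.extensionSetoid A I).symm (key T)))

/-- A complete cotorsion pair `(𝒞, 𝒞^⊥)` makes `𝒞` an exact category whose objects embed into those
of `𝒞 ∩ 𝒞^⊥`, which are relatively injective. -/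
lemma ExactStructure.embeddedContext {X : ExactStructure.{v, u, v', u'} E} {F : E ⥤ 𝒜}
    [F.Additive] [F.Full] [F.Faithful]
    (hF : ∀ S : ShortComplex E, X.conflation S ↔ (S.map F).ShortExact)
    (hFext : ∀ T : ShortComplex 𝒜, T.ShortExact →
      F.essImage T.X₁ → F.essImage T.X₃ → F.essImage T.X₂) {𝒞 𝒵 : ObjectProperty E}
    (h𝒞 : X.IsCompleteCotorsionPair 𝒞 (X.rightOrthogonal 𝒞)) (h𝒵 : X.rightOrthogonal 𝒞 ≤ 𝒵)
    (hext : ClosedUnderExtensions (X.conflationOn 𝒞) (𝒵.inverseImage 𝒞.ι))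
    (hcok : ClosedUnderCokernelsOfAdmissibleMonos (X.conflationOn 𝒞) (𝒵.inverseImage 𝒞.ι)) :
    HasZeroObject 𝒞.FullSubcategory ∧
      EmbeddedContext (X.conflationOn 𝒞) (𝒞.ι ⋙ F)
        ((X.rightOrthogonal 𝒞).inverseImage 𝒞.ι) (𝒵.inverseImage 𝒞.ι) := by
  have hExt := X.subsingleton_ext1_iff hF hFext
  have memC (A : E) : 𝒞 A ↔ ∀ I, X.rightOrthogonal 𝒞 I → ExtVanishes (F.obj A) (F.obj I) := by
    conv_lhs => rw [← h𝒞.left_eq]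
    exact forall₂_congr fun I _ => hExt A I
  have memR (I : E) : X.rightOrthogonal 𝒞 I ↔ ∀ A, 𝒞 A → ExtVanishes (F.obj A) (F.obj I) :=
    forall₂_congr fun A _ => hExt A I
  have extC (S : ShortComplex E) (hS : X.conflation S) (h₁ : 𝒞 S.X₁) (h₃ : 𝒞 S.X₃) : 𝒞 S.X₂ :=
    (memC _).2 fun I hI => ExtVanishes.of_shortExact ((hF S).1 hS) ((memC _).1 h₁ I hI)
      ((memC _).1 h₃ I hI)
  have zeroC : 𝒞 0 :=
    (memC _).2 fun I _ => ExtVanishes.of_isZero_left (F.map_isZero (isZero_zero E))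
  refine ⟨⟨⟨0, zeroC⟩, (IsZero.iff_id_eq_zero _).2
    (ObjectProperty.hom_ext _ ((isZero_zero E).eq_of_src _ _))⟩, ?_⟩
  exact
    { conf_iff := fun S => hF _
      ext_map := by
        rintro T hT ⟨A, -, ⟨e₁⟩⟩ ⟨C, -, ⟨e₃⟩⟩
        obtain ⟨B, ⟨e₂⟩⟩ := hFext T hT ⟨_, ⟨e₁⟩⟩ ⟨_, ⟨e₃⟩⟩
        obtain ⟨w, hw⟩ := exists_lift_of_shortExact hF hT e₁ e₂ e₃
        exact ⟨⟨B, extC _ hw A.property C.property⟩, trivial, ⟨e₂⟩⟩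
      ext := hext
      cok := hcok
      le := fun A hA => h𝒵 _ hA
      of_isZero := fun A hA => (memR _).2 fun _ _ =>
        ExtVanishes.of_isZero_right ((𝒞.ι ⋙ F).map_isZero hA)
      biprod := fun A B hA hB => by
        have hS := shortExact_inl_snd (F.obj A.obj) (F.obj B.obj)
        obtain ⟨M, ⟨e⟩⟩ := hFext _ hS (F.obj_mem_essImage _) (F.obj_mem_essImage _)
        obtain ⟨w, hw⟩ := exists_lift_of_shortExact hF hS (Iso.refl _) e (Iso.refl _)
        exact ⟨⟨M, extC _ hw A.property B.property⟩, (memR _).2 fun P hP =>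
          (((memR _).1 hA P hP).biprod ((memR _).1 hB P hP)).of_iso e.symm, ⟨e⟩⟩
      exists_mono := fun A => by
        obtain ⟨I, Q, i, p, w, hc, hI, hQ⟩ := h𝒞.exists_right_resolution A.obj
        exact ⟨⟨I, extC _ hc A.property hQ⟩, ObjectProperty.homMk i, hI, ⟨Q, hQ⟩,
          ObjectProperty.homMk p, ObjectProperty.hom_ext _ w, hc, trivial⟩
      exists_retraction := fun S hS hR => by
        obtain ⟨g, hg⟩ := (memR _).1 hR S.X₃.obj S.X₃.property _ _ _ ((hF _).1 hS) (𝟙 _)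
        obtain ⟨r, rfl⟩ := (𝒞.ι ⋙ F).map_surjective (X := S.X₂) (Y := S.X₁) g
        exact ⟨r, (𝒞.ι ⋙ F).map_injective
          (((𝒞.ι ⋙ F).map_comp _ _).trans (hg.trans ((𝒞.ι ⋙ F).map_id _).symm))⟩ }

end Orthogonality

end ExactCotorsion

theorem theorem4p1 {E : Type u} [Category.{v} E] [Preadditive E]
    [HasZeroObject E] [HasBinaryBiproducts E]
    (X : ExactCotorsion.ExactStructure.{v, u, v', u'} E) (𝒞 𝒵 : ObjectProperty E)
    (h𝒞 : X.IsCompleteHereditaryCotorsionPair 𝒞 (X.rightOrthogonal 𝒞))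
    (h𝒵 : X.rightOrthogonal 𝒞 ≤ 𝒵)
    (hext : ExactCotorsion.ClosedUnderExtensions (X.conflationOn 𝒞) (𝒵.inverseImage 𝒞.ι))
    (hcok : ExactCotorsion.ClosedUnderCokernelsOfAdmissibleMonos (X.conflationOn 𝒞)
      (𝒵.inverseImage 𝒞.ι)) :
    ∃ W : ExactCotorsion.WaldhausenStructure 𝒞.FullSubcategory,
      W.cof = ExactCotorsion.AdmissibleMono (X.conflationOn 𝒞) ∧
      W.weq = X.cotorsionWeq 𝒞 𝒵 := by
  obtain ⟨𝒜, _, _, F, _, _, _, hF, hFext⟩ := X.exists_embedding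
  obtain ⟨_, ctx⟩ := ExactCotorsion.ExactStructure.embeddedContext hF hFext
    h𝒞.toIsCompleteCotorsionPair h𝒵 hext hcok
  obtain ⟨W, hcof, hweq⟩ := ctx.exists_waldhausenStructure
  refine ⟨W, hcof, ?_⟩
  rw [hweq]
  ext A B f
  exact (ctx.exists_factorization_iff f).symm
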